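/- For a finite group $G$, let $\mathrm{Irr}(G)$ be the set of complex irreducible characters of $G$, let $\mathrm{nz}(G)$ be the number of zeros in the character table of $G$ (that is, the number of pairs $(\chi, C)$ with $\chi \in \mathrm{Irr}(G)$ and $C$ a conjugacy class of $G$ on which $\chi$ vanishes), and let $\mathrm{anz}(G) := \mathrm{nz}(G)/|\mathrm{Irr}(G)|$. A group is supersolvable if it has a finite series of normal subgroups $1 = H_0 \leq H_1 \leq \dots \leq H_n = G$ (each $H_i$ normal in $G$) with all factors $H_{i+1}/H_i$ cyclic. Theorem C. Let $G$ be a finite group. If $\mathrm{anz}(G) < \frac12$, then $G$ is supersolvable. The bound is sharp: the alternating group $\mathrm{A}_4$ is not supersolvable and $\mathrm{anz}(\mathrm{A}_4) = \frac12$. -/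

import Mathlib

/-- The set `Irr(G)` of complex irreducible characters of `G`, as functions `G → ℂ`: the characters
of the irreducible representations of `G` on `ℂⁿ`, `n ∈ ℕ` (every finite-dimensional complex
representation is isomorphic to one of this form, and isomorphic representations have the same
character). -/
def Irr (G : Type*) [Group G] : Set (G → ℂ) :=
  {χ | ∃ (n : ℕ) (ρ : Representation ℂ G (Fin n → ℂ)), ρ.IsIrreducible ∧ ρ.character = χ}

/-- The zeros of the character table of `G`: the pairs of an irreducible character and a conjugacy
class on which it vanishes. -/
def charTableZeros (G : Type*) [Group G] : Set ((G → ℂ) × ConjClasses G) :=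
  {p | p.1 ∈ Irr G ∧ ∀ g ∈ p.2.carrier, p.1 g = 0}

/-- `nz(G)`, the number of zeros in the character table of `G`. -/
noncomputable def nz (G : Type*) [Group G] : ℕ := (charTableZeros G).ncard

/-- `anz(G) = nz(G) / |Irr(G)|`, the average number of zeros of characters of `G`. -/
noncomputable def anz (G : Type*) [Group G] : ℚ := (nz G : ℚ) / ((Irr G).ncard : ℚ)

/-- `G` is supersolvable: there is a finite series `1 = H₀ ≤ H₁ ≤ ⋯ ≤ Hₙ = G` of normal subgroups
of `G` with every factor `Hᵢ₊₁ / Hᵢ` cyclic. -/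
def IsSupersolvable (G : Type*) [Group G] : Prop :=
  ∃ (n : ℕ) (H : Fin (n + 1) → Subgroup G) (_ : ∀ i, (H i).Normal),
    H 0 = ⊥ ∧ H (Fin.last n) = ⊤ ∧
      ∀ i : Fin n, H i.castSucc ≤ H i.succ ∧
        IsCyclic (H i.succ ⧸ (H i.castSucc).subgroupOf (H i.succ))

/-! Write `a = |G/G'|` and let `m` be the number of nonlinear irreducible characters, so that `|Irr
G| = a + m`. Burnside's theorem gives each nonlinear character a zero, so `m ≤ nz`, and the
hypothesis `2 nz < a + m` yields `nz < a`.

Linear characters act on nonlinear ones by multiplication. If `φχ = χ`, then `χ` vanishes wherever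
`φ ≠ 1`; by duality for `G/G'`, an orbit of size `o` contributes at least `o(a - o)` zeros, and `o`
divides `a`. The bounds leave only `o = 1`, so nonlinear characters vanish off `G'`. Counting again,
either `m = 0` and `G` is abelian, or `a = 2` and there is only one zero. In the second case `G \
G'` is a single class, which makes its elements involutions inverting `G'`; then `G'` is abelian,
all its subgroups are normal in `G`, and `G` is supersolvable.

Burnside's theorem rests on an integrality argument: the Galois conjugates of a nonzero character
value have mean square at least 1. For `A₄`, the only zeros are those of the tetrahedral character
on the two classes of 3-cycles, and no nontrivial cyclic subgroup is normal. -/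

/-! ### Integer polynomials at roots of unity -/

open Polynomial in
/-- The product of the values of an integer polynomial at the primitive `N`-th roots of unity is an
integer. -/
theorem exists_int_eq_prod_primitiveRoots (N : ℕ) [NeZero N] (P : ℤ[X]) :
    ∃ z : ℤ, ∏ μ ∈ primitiveRoots N ℂ, aeval μ P = z := by
  obtain ⟨ζ, hζ⟩ := (⟨_, Complex.isPrimitiveRoot_exp N (NeZero.ne N)⟩ : ∃ ζ : ℂ, IsPrimitiveRoot ζ N)
  -- The resultant is an integer by construction; over `ℂ`, where the monic cyclotomic polynomial
  -- splits, it is the product of the values of `P` at its roots.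
  refine ⟨resultant (cyclotomic N ℤ) P, ?_⟩
  have h := resultant_map_map (cyclotomic N ℤ) P (cyclotomic N ℤ).natDegree P.natDegree
    (Int.castRingHom ℂ)
  rw [map_cyclotomic] at h
  have h2 := resultant_eq_prod_eval (cyclotomic N ℂ) (P.map (Int.castRingHom ℂ)) P.natDegree
    natDegree_map_le (IsAlgClosed.splits _)
  rw [natDegree_cyclotomic] at h h2
  rw [h2, (cyclotomic.monic N ℂ).leadingCoeff, one_pow, one_mul] at h
  rw [natDegree_cyclotomic]
  rw [eq_intCast] at h
  rw [← h, cyclotomic.roots_eq_primitiveRoots_val]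
  change _ = Finset.prod _ _
  refine Finset.prod_congr rfl fun μ _ => ?_
  rw [aeval_def, eval_map]
  rfl

open Polynomial in
/-- If an integer polynomial does not vanish at a primitive `N`-th root of unity, the mean square
of its absolute values at all of them is at least `1`. -/
theorem totient_le_sum_normSq_primitiveRoots {N : ℕ} [NeZero N] (P : ℤ[X]) {ζ : ℂ}
    (hζ : IsPrimitiveRoot ζ N) (h : aeval ζ P ≠ 0) :
    (N.totient : ℝ) ≤ ∑ μ ∈ primitiveRoots N ℂ, ‖aeval μ P‖ ^ 2 := by
  have hne : ∀ μ ∈ primitiveRoots N ℂ, aeval μ P ≠ 0 := by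
    intro μ hμ h0
    rw [mem_primitiveRoots (NeZero.pos N)] at hμ
    apply h
    have hd : minpoly ℤ μ ∣ P :=
      minpoly.isIntegrallyClosed_dvd (hμ.isIntegral (NeZero.pos N)) h0
    rw [← cyclotomic_eq_minpoly hμ (NeZero.pos N), cyclotomic_eq_minpoly hζ (NeZero.pos N)] at hd
    exact aeval_eq_zero_of_dvd_aeval_eq_zero hd (minpoly.aeval ℤ ζ)
  obtain ⟨z, hz⟩ := exists_int_eq_prod_primitiveRoots N P
  have hz0 : z ≠ 0 := by
    rintro rfl
    rw [Int.cast_zero, Finset.prod_eq_zero_iff] at hz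
    obtain ⟨μ, hμ, h0⟩ := hz
    exact hne μ hμ h0
  -- The product of the values is a nonzero integer, so the logarithms have nonnegative sum; `log x
  -- ≤ x - 1` then plays the part of the AM-GM inequality.
  have hlog : 0 ≤ ∑ μ ∈ primitiveRoots N ℂ, Real.log (‖aeval μ P‖ ^ 2) := by
    rw [← Real.log_prod fun μ hμ => pow_ne_zero 2 (norm_ne_zero_iff.mpr (hne μ hμ))]
    rw [Finset.prod_pow, ← norm_prod, hz]
    apply Real.log_nonneg
    rw [Complex.norm_intCast]
    apply one_le_pow₀
    exact_mod_cast Int.one_le_abs hz0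
  have hle : ∑ μ ∈ primitiveRoots N ℂ, Real.log (‖aeval μ P‖ ^ 2) ≤
      ∑ μ ∈ primitiveRoots N ℂ, (‖aeval μ P‖ ^ 2 - 1) := by
    refine Finset.sum_le_sum fun μ hμ => Real.log_le_sub_one_of_pos ?_
    exact pow_pos (norm_pos_iff.mpr (hne μ hμ)) 2
  rw [Finset.sum_sub_distrib, Finset.sum_const, nsmul_eq_mul, mul_one, hζ.card_primitiveRoots] at hle
  linarith

open Module in
/-- The traces of the powers of an endomorphism of finite order are the values of an integer
polynomial at the powers of a root of unity. -/
theorem exists_trace_pow_eq_aeval {V : Type*} [AddCommGroup V] [Module ℂ V]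
    [FiniteDimensional ℂ V] (f : End ℂ V) {N : ℕ} [NeZero N] (hf : f ^ N = 1) {ζ : ℂ}
    (hζ : IsPrimitiveRoot ζ N) :
    ∃ P : Polynomial ℤ, ∀ j : ℕ,
      LinearMap.trace ℂ V (f ^ j) = Polynomial.aeval (ζ ^ j) P := by
  classical
  let E : Fin N → Submodule ℂ V := fun a => f.eigenspace (ζ ^ (a : ℕ))
  have hinj : Function.Injective fun a : Fin N => ζ ^ (a : ℕ) := fun a b hab =>
    Fin.ext (hζ.pow_inj a.2 b.2 hab)
  have hind : iSupIndep E := (End.eigenspaces_iSupIndep f).comp hinj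
  have hss : f.IsSemisimple := by
    refine Module.End.isSemisimple_of_squarefree_aeval_eq_zero
      (p := Polynomial.X ^ N - 1) ?_ (by simp [hf])
    exact (Polynomial.X_pow_sub_one_separable_iff.mpr (NeZero.ne _)).squarefree
  have htop : iSup E = ⊤ := by
    rw [eq_top_iff, ← End.iSup_maxGenEigenspace_eq_top f]
    refine iSup_le fun μ => ?_
    rw [hss.isFinitelySemisimple.maxGenEigenspace_eq_eigenspace]
    by_cases hμ : f.HasEigenvalue μ
    · have h1 : μ ^ N = 1 := by
        obtain ⟨v, hv⟩ := hμ.exists_hasEigenvector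
        have h2 := hv.pow_apply N
        rw [hf, End.one_apply] at h2
        have h3 : (μ ^ N - 1) • v = 0 := by rw [sub_smul, ← h2, one_smul, sub_self]
        exact sub_eq_zero.mp ((smul_eq_zero.mp h3).resolve_right hv.2)
      obtain ⟨i, hi, rfl⟩ := hζ.eq_pow_of_pow_eq_one h1
      exact le_iSup E ⟨i, hi⟩
    · rw [End.hasEigenvalue_iff, not_not] at hμ
      simp [hμ]
  have hint : DirectSum.IsInternal E :=
    (DirectSum.isInternal_submodule_iff_iSupIndep_and_iSup_eq_top _).mpr ⟨hind, htop⟩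
  -- The coefficient of `X ^ a` is the multiplicity of the eigenvalue `ζ ^ a`.
  refine ⟨∑ a : Fin N, Polynomial.C (finrank ℂ (E a) : ℤ) * Polynomial.X ^ (a : ℕ), fun j => ?_⟩
  have hpow : ∀ a, ∀ v ∈ E a, (f ^ j) v = (ζ ^ (a : ℕ)) ^ j • v := by
    intro a v hv
    by_cases h0 : v = 0
    · simp [h0]
    · exact End.HasEigenvector.pow_apply ⟨hv, h0⟩ j
  have hmap : ∀ a, Set.MapsTo (f ^ j) (E a) (E a) := fun a v hv => by
    rw [SetLike.mem_coe, hpow a v hv]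
    exact (E a).smul_mem _ hv
  rw [LinearMap.trace_eq_sum_trace_restrict hint hmap, map_sum]
  refine Finset.sum_congr rfl fun a _ => ?_
  have : (f ^ j).restrict (hmap a) = (ζ ^ (a : ℕ)) ^ j • LinearMap.id := by
    exact LinearMap.ext fun v => Subtype.ext (hpow a v v.2)
  rw [this, map_smul, LinearMap.trace_id]
  simp [← pow_mul, mul_comm]

/-! ### Orthogonality and Burnside's theorem on zeros -/

open Representation

theorem Irr.apply_conj {G : Type*} [Group G] {χ : G → ℂ} (h : χ ∈ Irr G) (g x : G) :
    χ (x * g * x⁻¹) = χ g := by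
  obtain ⟨n, ρ, _, rfl⟩ := h
  exact char_conj ρ g x

theorem Irr.sum_mul_inv_self {G : Type*} [Group G] [Fintype G] {χ : G → ℂ} (h : χ ∈ Irr G) :
    ∑ g, χ g * χ g⁻¹ = Nat.card G := by
  classical
  obtain ⟨n, ρ, hρ, rfl⟩ := h
  have hG : (Nat.card G : ℂ) ≠ 0 := Nat.cast_ne_zero.mpr Nat.card_pos.ne'
  let := invertibleOfNonzero hG
  have := char_orthonormal ρ ρ
  rw [if_pos ⟨Representation.Equiv.refl ρ⟩, inv_mul_eq_one₀ hG] at this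
  exact this.symm

theorem Irr.sum_mul_inv_of_ne {G : Type*} [Group G] [Fintype G] {χ ψ : G → ℂ} (h : χ ∈ Irr G)
    (h' : ψ ∈ Irr G) (hne : χ ≠ ψ) : ∑ g, χ g * ψ g⁻¹ = 0 := by
  classical
  obtain ⟨n, ρ, hρ, rfl⟩ := h
  obtain ⟨n', σ, hσ, rfl⟩ := h'
  have hG : (Nat.card G : ℂ) ≠ 0 := Nat.cast_ne_zero.mpr Nat.card_pos.ne'
  let := invertibleOfNonzero hG
  have := char_orthonormal ρ σ
  rw [if_neg fun ⟨φ⟩ => hne (char_iso φ).symm] at this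
  exact (mul_eq_zero.mp this).resolve_left (inv_ne_zero hG)

theorem Irr.linearIndependent (G : Type*) [Group G] [Finite G] :
    LinearIndependent ℂ (fun χ : Irr G => (χ : G → ℂ)) := by
  classical
  have := Fintype.ofFinite G
  rw [linearIndependent_iff']
  intro s c hc χ hχ
  have h : ∑ g, (∑ ψ ∈ s, c ψ • (ψ : G → ℂ)) g * χ.1 g⁻¹ = 0 := by rw [hc]; simp
  simp only [Finset.sum_apply, Pi.smul_apply, smul_eq_mul, Finset.sum_mul, mul_assoc] at h
  rw [Finset.sum_comm] at h
  simp only [← Finset.mul_sum] at h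
  rw [Finset.sum_eq_single_of_mem χ hχ] at h
  · rw [Irr.sum_mul_inv_self χ.2] at h
    exact (mul_eq_zero.mp h).resolve_right (Nat.cast_ne_zero.mpr Nat.card_pos.ne')
  · intro ψ _ hne
    rw [Irr.sum_mul_inv_of_ne ψ.2 χ.2 fun h => hne (Subtype.ext h), mul_zero]

theorem Irr.finite (G : Type*) [Group G] [Finite G] : (Irr G).Finite := by
  have := Fintype.ofFinite G
  exact (Irr.linearIndependent G).finite

/-- Characters descend to independent functions on the classes. Only this inequality is needed, to
bound the number of characters of `A₄` from above. -/
theorem Irr.ncard_le_card_conjClasses (G : Type*) [Group G] [Finite G] :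
    (Irr G).ncard ≤ Nat.card (ConjClasses G) := by
  have := Fintype.ofFinite (ConjClasses G)
  have : Fintype (Irr G) := (Irr.finite G).fintype
  let F : Irr G → ConjClasses G → ℂ := fun χ c => Quotient.liftOn c χ.1 (by
    intro a b hab
    obtain ⟨x, rfl⟩ := isConj_iff.mp hab
    exact (Irr.apply_conj χ.2 a x).symm)
  have hF : LinearIndependent ℂ F :=
    LinearIndependent.of_comp (LinearMap.funLeft ℂ ℂ (ConjClasses.mk (α := G)))
      (Irr.linearIndependent G)
  have := hF.fintype_card_le_finrank
  rwa [Module.finrank_fintype_fun_eq_card, ← Nat.card_eq_fintype_card, ← Nat.card_eq_fintype_card,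
    Nat.card_coe_set_eq] at this

/-- One polynomial serves all `j`, so for `j` prime to the group order the values at `g ^ j` are the
Galois conjugates of the value at `g`. -/
theorem Irr.exists_aeval {G : Type*} [Group G] [Finite G] {χ : G → ℂ} (h : χ ∈ Irr G) {ζ : ℂ}
    (hζ : IsPrimitiveRoot ζ (Nat.card G)) (g : G) :
    ∃ P : Polynomial ℤ, ∀ j : ℕ, χ (g ^ j) = Polynomial.aeval (ζ ^ j) P := by
  obtain ⟨n, ρ, hρ, rfl⟩ := h
  have : NeZero (Nat.card G) := ⟨Nat.card_pos.ne'⟩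
  obtain ⟨P, hP⟩ := exists_trace_pow_eq_aeval (ρ g)
    (by rw [← map_pow, pow_card_eq_one', map_one]) hζ
  exact ⟨P, fun j => by rw [← hP j, character, map_pow]⟩

theorem Irr.apply_inv {G : Type*} [Group G] [Finite G] {χ : G → ℂ} (h : χ ∈ Irr G) (g : G) :
    χ g⁻¹ = starRingEnd ℂ (χ g) := by
  have hζ := Complex.isPrimitiveRoot_exp (Nat.card G) Nat.card_pos.ne'
  obtain ⟨P, hP⟩ := Irr.exists_aeval h hζ g
  set ζ := Complex.exp (2 * Real.pi * Complex.I / (Nat.card G : ℕ))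
  have hn : ‖ζ‖ = 1 := hζ.norm'_eq_one Nat.card_pos.ne'
  have hpos : 0 < Nat.card G := Nat.card_pos
  have h1 : g⁻¹ = g ^ (Nat.card G - 1) := by
    rw [inv_eq_iff_mul_eq_one, ← pow_succ', Nat.sub_add_cancel hpos, pow_card_eq_one']
  have h2 : ζ ^ (Nat.card G - 1) = starRingEnd ℂ ζ := by
    rw [← Complex.inv_eq_conj hn]
    apply eq_inv_of_mul_eq_one_left
    rw [← pow_succ, Nat.sub_add_cancel hpos, hζ.pow_eq_one]
  have h3 := hP 1
  rw [pow_one, pow_one] at h3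
  rw [h1, hP, h2, h3, Polynomial.aeval_def, Polynomial.aeval_def, Polynomial.hom_eval₂]
  congr 1
  ext x
  simp

/-- Burnside: a nonlinear irreducible character has a zero. -/
theorem Irr.exists_eq_zero {G : Type*} [Group G] [Finite G] {χ : G → ℂ} (h : χ ∈ Irr G)
    (h1 : 1 < ‖χ 1‖) : ∃ g, χ g = 0 := by
  classical
  have := Fintype.ofFinite G
  by_contra! hne
  have : NeZero (Nat.card G) := ⟨Nat.card_pos.ne'⟩
  set N := Nat.card G with hN
  have hζ := Complex.isPrimitiveRoot_exp N (NeZero.ne N)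
  set ζ := Complex.exp (2 * Real.pi * Complex.I / (N : ℕ))
  have hsum : ∑ g, ‖χ g‖ ^ 2 = N := by
    have := Irr.sum_mul_inv_self h
    simp only [Irr.apply_inv h, Complex.mul_conj, Complex.normSq_eq_norm_sq] at this
    exact_mod_cast this
  have hprim : primitiveRoots N ℂ = ((Finset.range N).filter N.Coprime).image (ζ ^ ·) := by
    ext μ
    rw [mem_primitiveRoots (NeZero.pos N), hζ.isPrimitiveRoot_iff]
    simp [Nat.coprime_comm, and_assoc]
  have hinj : Set.InjOn (ζ ^ ·) (((Finset.range N).filter N.Coprime : Finset ℕ) : Set ℕ) := by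
    intro a ha b hb hab
    simp only [Finset.coe_filter, Finset.mem_range, Set.mem_ofPred_eq] at ha hb
    exact hζ.pow_inj ha.1 hb.1 hab
  have hg : ∀ g, (N.totient : ℝ) ≤ ∑ j ∈ (Finset.range N).filter N.Coprime, ‖χ (g ^ j)‖ ^ 2 := by
    intro g
    obtain ⟨P, hP⟩ := Irr.exists_aeval h hζ g
    have h0 : Polynomial.aeval ζ P ≠ 0 := by
      have := hP 1
      rw [pow_one, pow_one] at this
      rw [← this]
      exact hne g
    have := totient_le_sum_normSq_primitiveRoots P hζ h0
    rw [hprim, Finset.sum_image hinj] at this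
    simpa only [hP] using this
  -- For `j` prime to the group order, `g ↦ g ^ j` permutes `G`.
  have hbij : ∀ j ∈ (Finset.range N).filter N.Coprime, ∑ g, ‖χ (g ^ j)‖ ^ 2 = N := by
    intro j hj
    rw [← hsum]
    exact (powCoprime (Finset.mem_filter.mp hj).2).sum_comp fun g => ‖χ g‖ ^ 2
  have htot : ∑ g, ∑ j ∈ (Finset.range N).filter N.Coprime, ‖χ (g ^ j)‖ ^ 2 =
      ∑ g : G, (N.totient : ℝ) := by
    rw [Finset.sum_comm, Finset.sum_congr rfl hbij, Finset.sum_const, Finset.sum_const,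
      ← Nat.totient_eq_card_coprime, Finset.card_univ, ← Nat.card_eq_fintype_card]
    simp [mul_comm, hN]
  -- The bounds `hg` have equal totals on both sides, so each is an equality; at the identity this
  -- forces `‖χ 1‖ = 1`.
  have heq := (Finset.sum_eq_sum_iff_of_le fun g _ => hg g).mp htot.symm 1 (Finset.mem_univ _)
  simp only [one_pow, Finset.sum_const, ← Nat.totient_eq_card_coprime, nsmul_eq_mul] at heq
  have hpos : (0 : ℝ) < N.totient := Nat.cast_pos.mpr (Nat.totient_pos.mpr (NeZero.pos N))
  nlinarith [mul_pos hpos (by nlinarith : (0 : ℝ) < ‖χ 1‖ ^ 2 - 1)]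

/-! ### Linear characters, twisting and the commutative case -/

/-- The linear characters of `G`. -/
def linearChars (G : Type*) [Group G] : Set (G → ℂ) :=
  Set.range fun (φ : G →* ℂˣ) (g : G) => (φ g : ℂ)

/-- The twist of a representation by a linear character. -/
noncomputable def Representation.twist {G V : Type*} [Group G] [AddCommGroup V] [Module ℂ V]
    (φ : G →* ℂˣ) (ρ : Representation ℂ G V) : Representation ℂ G V where
  toFun g := (φ g : ℂ) • ρ g
  map_one' := by simp
  map_mul' g h := by simp only [map_mul, Units.val_mul, smul_mul_smul_comm]

theorem Representation.IsIrreducible.mk_of_forall {G V : Type*} [Group G] [AddCommGroup V]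
    [Module ℂ V] [Nontrivial V] (ρ : Representation ℂ G V)
    (h : ∀ p : Submodule ℂ V, (∀ g, ∀ v ∈ p, ρ g v ∈ p) → p ≠ ⊥ → p = ⊤) : ρ.IsIrreducible := by
  have : Nontrivial (Subrepresentation ρ) := by
    refine ⟨⊥, ⊤, fun he => ?_⟩
    exact bot_ne_top (α := Submodule ℂ V) (congrArg Subrepresentation.toSubmodule he)
  refine ⟨fun p => ?_⟩
  by_cases hp : p.toSubmodule = ⊥
  · exact Or.inl (Subrepresentation.toSubmodule_injective hp)
  · exact Or.inr (Subrepresentation.toSubmodule_injective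
      (h p.toSubmodule (fun g v hv => p.apply_mem_toSubmodule g hv) hp))

theorem Representation.IsIrreducible.nontrivial {G V : Type*} [Group G] [AddCommGroup V]
    [Module ℂ V] {ρ : Representation ℂ G V} (h : ρ.IsIrreducible) : Nontrivial V := by
  by_contra hV
  rw [not_nontrivial_iff_subsingleton] at hV
  have := h.toNontrivial
  obtain ⟨p, q, hpq⟩ := this
  exact hpq (Subrepresentation.toSubmodule_injective (Subsingleton.elim _ _))

theorem Representation.IsIrreducible.eq_top {G V : Type*} [Group G] [AddCommGroup V]
    [Module ℂ V] {ρ : Representation ℂ G V} (h : ρ.IsIrreducible) (p : Submodule ℂ V)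
    (hp : ∀ g, ∀ v ∈ p, ρ g v ∈ p) (hb : p ≠ ⊥) : p = ⊤ := by
  rcases h.eq_bot_or_eq_top ⟨p, fun g v hv => hp g v hv⟩ with h | h
  · exact absurd (congrArg Subrepresentation.toSubmodule h) hb
  · exact congrArg Subrepresentation.toSubmodule h

theorem Irr.twist_mem {G : Type*} [Group G] {χ : G → ℂ} (h : χ ∈ Irr G) (φ : G →* ℂˣ) :
    (fun g => (φ g : ℂ) * χ g) ∈ Irr G := by
  obtain ⟨n, ρ, hρ, rfl⟩ := h
  have := hρ.nontrivial
  refine ⟨n, ρ.twist φ, IsIrreducible.mk_of_forall _ fun p hp hb => hρ.eq_top p (fun g v hv => ?_) hb,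
    funext fun g => ?_⟩
  · have := p.smul_mem ((φ g : ℂ)⁻¹) (hp g v hv)
    change (φ g : ℂ)⁻¹ • ((φ g : ℂ) • ρ g v) ∈ p at this
    rwa [inv_smul_smul₀ (φ g).ne_zero] at this
  · exact map_smul (LinearMap.trace ℂ (Fin n → ℂ)) (φ g : ℂ) (ρ g)

theorem one_mem_Irr (G : Type*) [Group G] : (fun _ => 1) ∈ Irr G := by
  refine ⟨1, 1, IsIrreducible.mk_of_forall _ fun p _ hb => ?_, funext fun g => ?_⟩
  · have := is_simple_module_of_finrank_eq_one (A := ℂ) (Module.finrank_fin_fun ℂ (n := 1))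
    exact (eq_bot_or_eq_top p).resolve_left hb
  · simp [character]

theorem linearChars_subset_Irr (G : Type*) [Group G] : linearChars G ⊆ Irr G := by
  rintro _ ⟨φ, rfl⟩
  simpa using Irr.twist_mem (one_mem_Irr G) φ

theorem Irr.one_lt_norm_apply_one {G : Type*} [Group G] {χ : G → ℂ} (h : χ ∈ Irr G)
    (h' : χ ∉ linearChars G) : 1 < ‖χ 1‖ := by
  obtain ⟨n, ρ, hρ, rfl⟩ := h
  have := hρ.nontrivial
  rw [char_one, Module.finrank_fin_fun, Complex.norm_natCast, Nat.one_lt_cast]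
  by_contra! hn
  have hn0 : n ≠ 0 := by
    rintro rfl
    exact not_nontrivial _ this
  obtain rfl : n = 1 := by omega
  apply h'
  have hs : ∀ f : Module.End ℂ (Fin 1 → ℂ),
      f = LinearMap.trace ℂ (Fin 1 → ℂ) f • (1 : Module.End ℂ (Fin 1 → ℂ)) := by
    intro f
    ext i j
    rw [LinearMap.trace_eq_matrix_trace ℂ (Pi.basisFun ℂ (Fin 1))]
    fin_cases i
    fin_cases j
    simp [Matrix.trace]
  let ψ : G →* ℂ :=
    { toFun := ρ.character
      map_one' := by simp
      map_mul' := fun g k => by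
        change LinearMap.trace ℂ _ (ρ (g * k)) = _
        rw [map_mul, hs (ρ g), smul_one_mul, map_smul]
        simp [character] }
  exact ⟨ψ.toHomUnits, rfl⟩

/-- A finite group all of whose irreducible characters are linear is commutative. -/
theorem mul_comm_of_Irr_subset_linearChars {G : Type*} [Group G] [Finite G]
    (h : Irr G ⊆ linearChars G) (a b : G) : a * b = b * a := by
  classical
  have hG : NeZero (Nat.card G : ℂ) := ⟨Nat.cast_ne_zero.mpr Nat.card_pos.ne'⟩
  obtain ⟨n, d, hd, ⟨e⟩⟩ := IsSemisimpleRing.exists_algEquiv_pi_matrix_of_isAlgClosed ℂ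
    (MonoidAlgebra ℂ G)
  -- Each Wedderburn block acts irreducibly on its column space, so its size is the degree of an
  -- irreducible character. With all blocks of size one, the group algebra is commutative.
  have hd1 : ∀ i, d i = 1 := by
    intro i
    have := hd i
    let T : MonoidAlgebra ℂ G →ₐ[ℂ] Module.End ℂ (Fin (d i) → ℂ) :=
      ((Matrix.toLinAlgEquiv' : Matrix (Fin (d i)) (Fin (d i)) ℂ ≃ₐ[ℂ] _).toAlgHom.comp
        (Pi.evalAlgHom ℂ _ i)).comp e.toAlgHom
    have hT : Function.Surjective T := by
      intro f
      obtain ⟨A, rfl⟩ := Matrix.toLinAlgEquiv'.surjective f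
      obtain ⟨x, hx⟩ := e.surjective (Pi.single i A)
      refine ⟨x, ?_⟩
      change Matrix.toLinAlgEquiv' (e x i) = _
      rw [hx, Pi.single_eq_same]
    let ρ : Representation ℂ G (Fin (d i) → ℂ) :=
      (T : MonoidAlgebra ℂ G →* Module.End ℂ (Fin (d i) → ℂ)).comp (MonoidAlgebra.of ℂ G)
    have hρ : ρ.IsIrreducible := by
      refine IsIrreducible.mk_of_forall _ fun p hp hb => ?_
      have hall : ∀ f : Module.End ℂ (Fin (d i) → ℂ), ∀ v ∈ p, f v ∈ p := by
        intro f v hv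
        obtain ⟨x, rfl⟩ := hT f
        induction x using MonoidAlgebra.induction_on with
        | of g => exact hp g v hv
        | add x y hx hy =>
          rw [map_add]
          exact p.add_mem hx hy
        | smul r x hx =>
          rw [map_smul]
          exact p.smul_mem r hx
      obtain ⟨v, hv, hv0⟩ := p.ne_bot_iff.mp hb
      rw [eq_top_iff]
      intro w _
      obtain ⟨f, hf⟩ : ∃ f : Module.End ℂ (Fin (d i) → ℂ), f v = w := by
        obtain ⟨j, hj⟩ := Function.ne_iff.mp hv0
        refine ⟨(LinearMap.proj j).smulRight ((v j)⁻¹ • w), ?_⟩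
        rw [LinearMap.smulRight_apply, LinearMap.proj_apply, smul_inv_smul₀ hj]
      exact hf ▸ hall f v hv
    obtain ⟨φ, hφ⟩ := h ⟨d i, ρ, hρ, rfl⟩
    have := congrFun hφ 1
    rw [char_one, Module.finrank_fin_fun] at this
    simpa using this.symm
  have hof : MonoidAlgebra.of ℂ G (a * b) = MonoidAlgebra.of ℂ G (b * a) := by
    apply e.injective
    rw [map_mul, map_mul, map_mul, map_mul]
    ext i x y
    have : Subsingleton (Fin (d i)) := by rw [hd1 i]; infer_instance
    simp only [Pi.mul_apply, Matrix.mul_apply]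
    refine Finset.sum_congr rfl fun z _ => ?_
    rw [Subsingleton.elim x y, Subsingleton.elim z y, mul_comm]
  exact MonoidAlgebra.of_injective hof

/-! ### Counting zeros -/

/-- The conjugacy classes on which `χ` vanishes. -/
def zeroClasses {G : Type*} [Group G] (χ : G → ℂ) : Set (ConjClasses G) :=
  {c | ∀ g ∈ c.carrier, χ g = 0}

theorem Irr.mk_mem_zeroClasses {G : Type*} [Group G] {χ : G → ℂ} (h : χ ∈ Irr G) {g : G} :
    ConjClasses.mk g ∈ zeroClasses χ ↔ χ g = 0 := by
  refine ⟨fun hg => hg g ConjClasses.mem_carrier_mk, fun hg x hx => ?_⟩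
  obtain ⟨y, rfl⟩ := isConj_iff.mp (ConjClasses.mem_carrier_iff_mk_eq.trans
    ConjClasses.mk_eq_mk_iff_isConj |>.mp hx).symm
  rw [Irr.apply_conj h, hg]

theorem charTableZeros_finite (G : Type*) [Group G] [Finite G] : (charTableZeros G).Finite :=
  ((Irr.finite G).prod Set.finite_univ).subset fun _ hp => ⟨hp.1, Set.mem_univ _⟩

theorem nz_eq_sum (G : Type*) [Group G] [Finite G] :
    nz G = ∑ χ ∈ (Irr.finite G).toFinset, (zeroClasses χ).ncard := by
  classical
  have hfin : ∀ χ : G → ℂ, (zeroClasses χ).Finite := fun χ => Set.toFinite _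
  have : charTableZeros G = (((Irr.finite G).toFinset.sigma fun χ => (hfin χ).toFinset).map
      (Equiv.sigmaEquivProd (G → ℂ) (ConjClasses G)).toEmbedding : Set _) := by
    ext ⟨χ, c⟩
    simp [charTableZeros, zeroClasses]
  rw [nz, this, Set.ncard_coe_finset, Finset.card_map, Finset.card_sigma]
  exact Finset.sum_congr rfl fun χ _ => (Set.ncard_eq_toFinset_card _ (hfin χ)).symm

theorem ncard_mul_le_nz {G : Type*} [Group G] [Finite G] {T : Set (G → ℂ)} (hT : T ⊆ Irr G)
    {b : ℕ} (hb : ∀ χ ∈ T, b ≤ (zeroClasses χ).ncard) : T.ncard * b ≤ nz G := by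
  have hfin : T.Finite := (Irr.finite G).subset hT
  rw [nz_eq_sum, Set.ncard_eq_toFinset_card T hfin]
  calc hfin.toFinset.card * b ≤ ∑ χ ∈ hfin.toFinset, (zeroClasses χ).ncard :=
        Finset.card_nsmul_le_sum _ _ _ fun χ hχ => hb χ (hfin.mem_toFinset.mp hχ)
    _ ≤ _ := Finset.sum_le_sum_of_subset (Set.Finite.toFinset_subset_toFinset.mpr hT)

theorem ncard_linearChars (G : Type*) [Group G] [Finite G] :
    (linearChars G).ncard = Nat.card (Abelianization G) := by
  have hinj : Function.Injective fun (φ : G →* ℂˣ) (g : G) => (φ g : ℂ) := fun φ ψ h =>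
    MonoidHom.ext fun g => Units.ext (congrFun h g)
  rw [linearChars, ← Set.image_univ, Set.ncard_image_of_injective _ hinj, Set.ncard_univ,
    Nat.card_congr Abelianization.lift, CommGroup.card_monoidHom_of_hasEnoughRootsOfUnity]

theorem ncard_Irr (G : Type*) [Group G] [Finite G] :
    (Irr G).ncard = Nat.card (Abelianization G) + (Irr G \ linearChars G).ncard := by
  rw [← ncard_linearChars, add_comm,
    Set.ncard_sdiff_add_ncard_of_subset (linearChars_subset_Irr G) (Irr.finite G)]

theorem ncard_nonlinear_le_nz (G : Type*) [Group G] [Finite G] :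
    (Irr G \ linearChars G).ncard ≤ nz G := by
  have := ncard_mul_le_nz (G := G) (T := Irr G \ linearChars G) (b := 1) Set.sdiff_subset ?_
  · rwa [mul_one] at this
  · intro χ hχ
    obtain ⟨g, hg⟩ := Irr.exists_eq_zero hχ.1 (Irr.one_lt_norm_apply_one hχ.1 hχ.2)
    exact (Set.ncard_pos (Set.toFinite _)).mpr
      ⟨ConjClasses.mk g, (Irr.mk_mem_zeroClasses hχ.1).mpr hg⟩

/-- A class function that vanishes at all elements lying over a set of elements of the
abelianization has at least that many zeros. -/
theorem Irr.ncard_le_ncard_zeroClasses {G : Type*} [Group G] [Finite G] {χ : G → ℂ}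
    (h : χ ∈ Irr G) (S : Set (Abelianization G))
    (hS : ∀ g, Abelianization.of g ∈ S → χ g = 0) : S.ncard ≤ (zeroClasses χ).ncard := by
  have hsurj : ∀ a : Abelianization G, ∃ g, Abelianization.of g = a := fun a =>
    QuotientGroup.mk_surjective a
  choose t ht using hsurj
  -- Conjugate elements agree in the abelianization, so lifts of distinct elements lie in distinct
  -- classes.
  let s : Abelianization G → ConjClasses G := fun a => ConjClasses.mk (t a)
  have hinj : Function.Injective s := by
    intro a b hab
    obtain ⟨x, hx⟩ := isConj_iff.mp (ConjClasses.mk_eq_mk_iff_isConj.mp hab)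
    rw [← ht a, ← ht b, ← hx, map_mul, map_mul, map_inv, mul_inv_cancel_comm]
  rw [← Set.ncard_image_of_injective S hinj]
  refine Set.ncard_le_ncard ?_ (Set.toFinite _)
  rintro _ ⟨a, ha, rfl⟩
  exact (Irr.mk_mem_zeroClasses h).mpr (hS _ (by rwa [ht]))

/-! ### Orbits under multiplication by linear characters -/

/-- The action of the linear characters on functions by multiplication. -/
noncomputable instance linearCharAction (G : Type*) [Group G] :
    MulAction (Abelianization G →* ℂˣ) (G → ℂ) where
  smul φ χ := fun g => (φ (Abelianization.of g) : ℂ) * χ g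
  one_smul χ := funext fun g => by
    change ((1 : Abelianization G →* ℂˣ) _ : ℂ) * χ g = χ g
    simp
  mul_smul φ ψ χ := funext fun g => mul_assoc _ _ _

theorem linearChar_smul_apply {G : Type*} [Group G] (φ : Abelianization G →* ℂˣ) (χ : G → ℂ)
    (g : G) : (φ • χ) g = (φ (Abelianization.of g) : ℂ) * χ g := rfl

theorem linearChar_smul_mem {G : Type*} [Group G] (φ : Abelianization G →* ℂˣ) {χ : G → ℂ}
    (h : χ ∈ Irr G \ linearChars G) : φ • χ ∈ Irr G \ linearChars G := by
  refine ⟨Irr.twist_mem h.1 (φ.comp Abelianization.of), ?_⟩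
  rintro ⟨ψ, hψ⟩
  refine h.2 ⟨(φ.comp Abelianization.of)⁻¹ * ψ, funext fun g => ?_⟩
  have := congrFun hψ g
  rw [linearChar_smul_apply] at this
  simp [this]

/-- Let `H` be the common kernel in the abelianization of the linear characters fixing `χ`. By
duality, `|H|` is the index of the stabilizer, that is, the orbit size. Outside `H` some fixing
character differs from 1, so `χ` and all its twists vanish there. -/
theorem ncard_orbit_mul_le_nz {G : Type*} [Group G] [Finite G] {χ : G → ℂ}
    (h : χ ∈ Irr G \ linearChars G) :
    (MulAction.orbit (Abelianization G →* ℂˣ) χ).ncard ∣ Nat.card (Abelianization G) ∧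
    (MulAction.orbit (Abelianization G →* ℂˣ) χ).ncard * (Nat.card (Abelianization G) -
      (MulAction.orbit (Abelianization G →* ℂˣ) χ).ncard) ≤ nz G := by
  set A := Abelianization G
  let Φ := MulAction.stabilizer (A →* ℂˣ) χ
  let H : Subgroup A := (CommGroup.subgroupOrderIsoSubgroupMonoidHom A ℂ).symm (OrderDual.toDual Φ)
  have hcard : (MulAction.orbit (A →* ℂˣ) χ).ncard = Nat.card H := by
    have h1 : Nat.card Φ = Nat.card (A ⧸ H) := by
      rw [← CommGroup.card_subgroupOrderIsoSubgroupMonoidHom (M := ℂ) H, OrderIso.apply_symm_apply]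
      rfl
    have h2 := Φ.card_eq_card_quotient_mul_card_subgroup
    have h3 := H.card_eq_card_quotient_mul_card_subgroup
    rw [CommGroup.card_monoidHom_of_hasEnoughRootsOfUnity, h3, h1, mul_comm] at h2
    rw [← Nat.card_coe_set_eq, Nat.card_congr (MulAction.orbitEquivQuotientStabilizer _ χ)]
    exact (Nat.eq_of_mul_eq_mul_right Nat.card_pos h2).symm
  rw [hcard]
  refine ⟨H.card_subgroup_dvd_card, ?_⟩
  rw [← hcard]
  refine ncard_mul_le_nz ?_ ?_
  · rintro _ ⟨φ, rfl⟩
    exact (linearChar_smul_mem φ h).1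
  · rintro _ ⟨φ, rfl⟩
    have hle := Irr.ncard_le_ncard_zeroClasses (linearChar_smul_mem φ h).1 ((H : Set A)ᶜ) ?_
    · rwa [Set.ncard_compl, ← Nat.card_coe_set_eq (H : Set A), SetLike.coe_sort_coe,
        ← hcard] at hle
    · intro g hg
      rw [linearChar_smul_apply]
      have : ¬ ∀ ψ ∈ Φ, ψ (Abelianization.of g) = 1 := fun hn => hg
        ((CommGroup.mem_subgroupOrderIsoSubgroupMonoidHom_symm_iff (M := ℂ) Φ _).mpr hn)
      push Not at this
      obtain ⟨ψ, hψ, hne⟩ := this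
      have h1 := congrFun (MulAction.mem_stabilizer_iff.mp hψ) g
      rw [linearChar_smul_apply] at h1
      have h0 : χ g = 0 := by
        by_contra h0
        exact hne (Units.ext ((mul_eq_right₀ h0).mp h1))
      rw [h0, mul_zero]

/-! ### Consequences of the bound on zeros -/

/-- If `anz G < 1 / 2`, all nonlinear irreducible characters are invariant under multiplication by
linear characters. -/
theorem linearChar_smul_eq {G : Type*} [Group G] [Finite G] (hG : 2 * nz G < (Irr G).ncard)
    {χ : G → ℂ} (h : χ ∈ Irr G \ linearChars G) (φ : Abelianization G →* ℂˣ) : φ • χ = χ := by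
  obtain ⟨⟨k, hk⟩, hle⟩ := ncard_orbit_mul_le_nz h
  have hm := ncard_nonlinear_le_nz G
  rw [ncard_Irr] at hG
  have hsub : (MulAction.orbit (Abelianization G →* ℂˣ) χ).ncard ≤ (Irr G \ linearChars G).ncard := by
    refine Set.ncard_le_ncard ?_ ((Irr.finite G).subset Set.sdiff_subset)
    rintro _ ⟨φ, rfl⟩
    exact linearChar_smul_mem φ h
  have hpos : 0 < (MulAction.orbit (Abelianization G →* ℂˣ) χ).ncard := by
    refine (Set.ncard_pos ((Irr.finite G).subset ?_)).mpr ⟨χ, MulAction.mem_orbit_self χ⟩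
    rintro _ ⟨φ, rfl⟩
    exact (linearChar_smul_mem φ h).1
  have h1 : (MulAction.orbit (Abelianization G →* ℂˣ) χ).ncard = 1 := by
    generalize (MulAction.orbit (Abelianization G →* ℂˣ) χ).ncard = o at *
    by_contra ho
    -- If `k = 1`, the orbit has `|G/G'|` members, but there are at most `nz G` nonlinear characters
    -- and `nz G < |G/G'|`.
    have hk2 : 2 ≤ k := by
      by_contra! hk2
      interval_cases k <;> omega
    obtain ⟨k, rfl⟩ := Nat.exists_eq_add_of_le' hk2
    have : Nat.card (Abelianization G) - o = o * (k + 1) := by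
      rw [hk, Nat.sub_eq_iff_eq_add (Nat.le_mul_of_pos_right o (by omega))]
      ring
    rw [this] at hle
    -- Since `o ≥ 2`, `o * (o * (k + 1)) ≥ 2 * o * (k + 1) ≥ o * (k + 2)`, which is `|G/G'|` and
    -- exceeds `nz G`.
    nlinarith [Nat.mul_le_mul (show 2 ≤ o by omega) (le_refl (o * (k + 1)))]
  obtain ⟨ψ, hψ⟩ := Set.ncard_eq_one.mp h1
  have e1 : χ ∈ ({ψ} : Set (G → ℂ)) := hψ ▸ MulAction.mem_orbit_self χ
  have e2 : φ • χ ∈ ({ψ} : Set (G → ℂ)) := hψ ▸ MulAction.mem_orbit χ φ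
  rw [Set.mem_singleton_iff] at e1 e2
  rw [e2, ← e1]

/-- If `anz G < 1 / 2`, all nonlinear irreducible characters vanish off the commutator subgroup. -/
theorem eq_zero_of_notMem_commutator {G : Type*} [Group G] [Finite G]
    (hG : 2 * nz G < (Irr G).ncard) {χ : G → ℂ} (h : χ ∈ Irr G \ linearChars G) {g : G}
    (hg : Abelianization.of g ≠ 1) : χ g = 0 := by
  obtain ⟨φ, hφ⟩ := CommGroup.exists_apply_ne_one_of_hasEnoughRootsOfUnity _ ℂ hg
  have h1 := congrFun (linearChar_smul_eq hG h φ) g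
  rw [linearChar_smul_apply] at h1
  by_contra h0
  exact hφ (Units.ext ((mul_eq_right₀ h0).mp h1))

/-- If `anz G < 1 / 2`, then all irreducible characters are linear, or there are two linear and one
nonlinear irreducible characters, and the latter has a single zero. -/
theorem linear_or_card_eq {G : Type*} [Group G] [Finite G] (hG : 2 * nz G < (Irr G).ncard) :
    Irr G ⊆ linearChars G ∨ (Nat.card (Abelianization G) = 2 ∧ nz G ≤ 1 ∧
      (Irr G \ linearChars G).Nonempty) := by
  by_cases hne : (Irr G \ linearChars G).Nonempty
  · right
    have hle := ncard_mul_le_nz (G := G) (T := Irr G \ linearChars G)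
      (b := Nat.card (Abelianization G) - 1) Set.sdiff_subset ?_
    · have hpos := (Set.ncard_pos ((Irr.finite G).subset Set.sdiff_subset)).mpr hne
      have hm := ncard_nonlinear_le_nz G
      rw [ncard_Irr] at hG
      generalize (Irr G \ linearChars G).ncard = m at *
      obtain ⟨l, hl⟩ : ∃ l, Nat.card (Abelianization G) = l + 2 :=
        Nat.exists_eq_add_of_le' (by omega)
      rw [hl] at hle hG ⊢
      rw [show l + 2 - 1 = l + 1 by omega] at hle
      -- Combining `m * (l + 1) ≤ nz G` with `2 * nz G < l + 2 + m` gives `m * (2 * l + 1) < l + 2`,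
      -- impossible for `m, l ≥ 1`.
      obtain rfl : l = 0 := by
        by_contra h0
        nlinarith [Nat.mul_le_mul hpos (Nat.pos_of_ne_zero h0)]
      exact ⟨rfl, by omega, hne⟩
    · intro χ hχ
      have := Irr.ncard_le_ncard_zeroClasses hχ.1 {1}ᶜ fun g hg =>
        eq_zero_of_notMem_commutator hG hχ hg
      rwa [Set.ncard_compl, Set.ncard_singleton] at this
  · left
    rwa [Set.sdiff_nonempty, not_not] at hne

/-- A nonlinear character vanishes on both classes; distinct classes would give two zeros. -/
theorem isConj_of_nz_le_one {G : Type*} [Group G] [Finite G] (hG : 2 * nz G < (Irr G).ncard)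
    (h1 : nz G ≤ 1) (hne : (Irr G \ linearChars G).Nonempty) {g h : G}
    (hg : Abelianization.of g ≠ 1) (hh : Abelianization.of h ≠ 1) : IsConj g h := by
  obtain ⟨χ, hχ⟩ := hne
  have := (Set.ncard_le_one (charTableZeros_finite G)).mp h1 (χ, ConjClasses.mk g)
    ⟨hχ.1, (Irr.mk_mem_zeroClasses hχ.1).mpr (eq_zero_of_notMem_commutator hG hχ hg)⟩
    (χ, ConjClasses.mk h)
    ⟨hχ.1, (Irr.mk_mem_zeroClasses hχ.1).mpr (eq_zero_of_notMem_commutator hG hχ hh)⟩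
  exact ConjClasses.mk_eq_mk_iff_isConj.mp (Prod.ext_iff.mp this).2

/-! ### Supersolvability and subgroups of index two -/

/-- A group is supersolvable if it is generated by a finite sequence all whose initial segments
generate normal subgroups. -/
theorem IsSupersolvable.of_closure_normal {G : Type*} [Group G] {n : ℕ} (x : Fin n → G)
    (hx : ∀ i : Fin (n + 1), (Subgroup.closure (x '' {j | j.castSucc < i})).Normal)
    (htop : Subgroup.closure (Set.range x) = ⊤) : IsSupersolvable G := by
  have hbot : Subgroup.closure (x '' {j | j.castSucc < 0}) = ⊥ := by
    have : {j : Fin n | j.castSucc < 0} = ∅ :=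
      Set.eq_empty_of_forall_notMem fun j hj => Fin.not_lt_zero _ hj
    rw [this, Set.image_empty, Subgroup.closure_empty]
  have hlast : Subgroup.closure (x '' {j | j.castSucc < Fin.last n}) = ⊤ := by
    have : {j : Fin n | j.castSucc < Fin.last n} = Set.univ :=
      Set.eq_univ_of_forall Fin.castSucc_lt_last
    rw [this, Set.image_univ, htop]
  refine ⟨n, fun i => Subgroup.closure (x '' {j | j.castSucc < i}), hx, hbot, hlast,
    fun i => ⟨?_, ?_⟩⟩
  · refine Subgroup.closure_mono (Set.image_mono fun j hj => ?_)
    exact lt_trans hj (Fin.castSucc_lt_succ (i := i))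
  · have := hx i.castSucc
    have hs : {j : Fin n | j.castSucc < i.succ} = insert i {j | j.castSucc < i.castSucc} := by
      ext j
      simp only [Set.mem_ofPred_eq, Set.mem_insert_iff, Fin.castSucc_lt_succ_iff,
        Fin.castSucc_lt_castSucc_iff]
      exact le_iff_eq_or_lt
    have hsup : Subgroup.closure (x '' {j | j.castSucc < i.succ}) =
        Subgroup.closure (x '' {j | j.castSucc < i.castSucc}) ⊔ Subgroup.zpowers (x i) := by
      rw [hs, Set.image_insert_eq, Set.insert_eq, Set.union_comm, Subgroup.closure_union,
        Subgroup.zpowers_eq_closure]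
    have hxi : x i ∈ Subgroup.closure (x '' {j | j.castSucc < i.succ}) :=
      Subgroup.subset_closure ⟨i, Fin.castSucc_lt_succ, rfl⟩
    refine ⟨QuotientGroup.mk ⟨x i, hxi⟩, fun q => ?_⟩
    obtain ⟨⟨y, hy⟩, rfl⟩ := QuotientGroup.mk_surjective q
    have hy' : y ∈ Subgroup.closure (x '' {j | j.castSucc < i.succ}) := hy
    rw [hsup, ← SetLike.mem_coe, Subgroup.normal_mul, Set.mem_mul] at hy'
    obtain ⟨a, ha, _, ⟨k, rfl⟩, rfl⟩ := hy'
    refine ⟨k, ?_⟩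
    change (QuotientGroup.mk ((⟨x i, hxi⟩ : Subgroup.closure _) ^ k) : _ ⧸ _) = _
    rw [QuotientGroup.eq, Subgroup.mem_subgroupOf]
    have := (hx i.castSucc).conj_mem a ha (x i ^ k)⁻¹
    simpa [mul_assoc] using this

/-- A group with a finite subgroup `H` all of whose subgroups are normal in the group, and that is
generated by `H` and one more element, is supersolvable. -/
theorem IsSupersolvable.of_forall_normal {G : Type*} [Group G] (H : Subgroup G) [Finite H] (t : G)
    (hH : ∀ K ≤ H, K.Normal) (ht : H ⊔ Subgroup.zpowers t = ⊤) : IsSupersolvable G := by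
  obtain ⟨n, ⟨e⟩⟩ := Finite.exists_equiv_fin H
  have hrange : Subgroup.closure (Set.range (Fin.snoc (fun i => (e.symm i : G)) t :
      Fin (n + 1) → G)) = ⊤ := by
    rw [eq_top_iff, ← ht, sup_le_iff, Subgroup.zpowers_le]
    refine ⟨fun h hh => Subgroup.subset_closure ⟨(e ⟨h, hh⟩).castSucc, ?_⟩,
      Subgroup.subset_closure ⟨Fin.last n, ?_⟩⟩
    · rw [Fin.snoc_castSucc, Equiv.symm_apply_apply]
    · rw [Fin.snoc_last]
  refine IsSupersolvable.of_closure_normal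
    (Fin.snoc (fun i => (e.symm i : G)) t : Fin (n + 1) → G) (fun i => ?_) hrange
  induction i using Fin.lastCases with
  | last =>
    have : {j : Fin (n + 1) | j.castSucc < Fin.last (n + 1)} = Set.univ :=
      Set.eq_univ_of_forall Fin.castSucc_lt_last
    rw [this, Set.image_univ, hrange]
    infer_instance
  | cast i =>
    apply hH
    rw [Subgroup.closure_le]
    rintro _ ⟨j, hj, rfl⟩
    induction j using Fin.lastCases with
    | last =>
      exact absurd (Fin.castSucc_lt_castSucc_iff.mp hj) (Fin.le_last i).not_gt
    | cast j =>
      rw [Fin.snoc_castSucc]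
      exact (e.symm j).2

/-- If the complement of a subgroup of index two is a single conjugacy class, its elements invert
the subgroup. -/
theorem conj_eq_inv_of_index_two {G : Type*} [Group G] [Finite G] {N : Subgroup G}
    (hN : N.index = 2) (hconj : ∀ g h, g ∉ N → h ∉ N → IsConj g h) {t a : G} (ht : t ∉ N)
    (ha : a ∈ N) : t * a * t⁻¹ = a⁻¹ := by
  have hnorm : N.Normal := Subgroup.normal_of_index_eq_two hN
  have hsq : ∀ g ∉ N, g * g = 1 := by
    intro g hg
    let f : N → ((N : Set G)ᶜ : Set G) := fun x => ⟨x * g * (x : G)⁻¹, fun h => hg (by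
      have := hnorm.conj_mem _ h (x : G)⁻¹
      simpa [mul_assoc] using this)⟩
    have hsurj : Function.Surjective f := by
      rintro ⟨h, hh⟩
      obtain ⟨y, rfl⟩ := isConj_iff.mp (hconj g h hg hh)
      by_cases hy : y ∈ N
      · exact ⟨⟨y, hy⟩, rfl⟩
      -- A conjugator outside `N` may be multiplied by `g`, which centralizes itself, to land in
      -- `N`.
      · refine ⟨⟨y * g, (Subgroup.mul_mem_iff_of_index_two hN).mpr (iff_of_false hy hg)⟩,
          Subtype.ext ?_⟩
        change y * g * g * (y * g)⁻¹ = y * g * y⁻¹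
        group
    have hcard : Nat.card N = Nat.card ((N : Set G)ᶜ : Set G) := by
      have h1 := N.card_mul_index
      rw [hN] at h1
      have h2 : Nat.card ((N : Set G)ᶜ : Set G) = Nat.card G - Nat.card N := by
        rw [Nat.card_coe_set_eq, Set.ncard_compl, ← Nat.card_coe_set_eq, SetLike.coe_sort_coe]
      omega
    have hinj : Function.Injective f :=
      ((Nat.bijective_iff_surjective_and_card f).mpr ⟨hsurj, hcard⟩).1
    -- Both `g * g` and `1` lie in `N` and fix `g` under conjugation, so injectivity identifies
    -- them.
    have := @hinj ⟨g * g, (Subgroup.mul_mem_iff_of_index_two hN).mpr Iff.rfl⟩ 1 (Subtype.ext (by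
      change g * g * g * (g * g)⁻¹ = 1 * g * 1⁻¹
      group))
    exact congrArg Subtype.val this
  -- Both `t` and `t * a` lie outside `N`, hence square to 1; together these relations say that `t`
  -- inverts `a`.
  have h1 := hsq (t * a) fun h => ht ((Subgroup.mul_mem_cancel_right N ha).mp h)
  have h2 := hsq t ht
  rw [inv_eq_of_mul_eq_one_left h2, eq_inv_iff_mul_eq_one, ← h1]
  group

/-- For `b ∈ N`, both `t` and `t * b` invert each `a ∈ N`, so `b` centralizes `a`. Hence conjugation
fixes or inverts the elements of `N`, and every subgroup of `N` is normal in `G`. -/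
theorem isSupersolvable_of_index_two {G : Type*} [Group G] [Finite G] {N : Subgroup G}
    (hN : N.index = 2) (hconj : ∀ g h, g ∉ N → h ∉ N → IsConj g h) : IsSupersolvable G := by
  obtain ⟨t, ht⟩ : ∃ t, t ∉ N := by
    by_contra! h
    rw [N.eq_top_iff'.mpr h, Subgroup.index_top] at hN
    omega
  have hcomm : ∀ a ∈ N, ∀ b ∈ N, b * a * b⁻¹ = a := by
    intro a ha b hb
    have h1 := conj_eq_inv_of_index_two hN hconj ht ha
    have h2 := conj_eq_inv_of_index_two hN hconj (t := t * b)
      (fun h => ht ((Subgroup.mul_mem_cancel_right N hb).mp h)) ha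
    have h3 : t * (b * a * b⁻¹) * t⁻¹ = t * a * t⁻¹ := by
      rw [h1, ← h2]
      group
    exact mul_left_cancel (mul_right_cancel h3)
  refine IsSupersolvable.of_forall_normal N t (fun K hK => ⟨fun a ha g => ?_⟩) ?_
  · by_cases hg : g ∈ N
    · rwa [hcomm a (hK ha) g hg]
    · rw [conj_eq_inv_of_index_two hN hconj hg (hK ha)]
      exact K.inv_mem ha
  · rw [eq_top_iff]
    intro g _
    by_cases hg : g ∈ N
    · exact Subgroup.mem_sup_left hg
    · have : g * t ∈ N := (Subgroup.mul_mem_iff_of_index_two hN).mpr (iff_of_false hg ht)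
      rw [← mul_inv_cancel_right g t]
      exact Subgroup.mul_mem_sup this (inv_mem (Subgroup.mem_zpowers t))

theorem isSupersolvable_of_anz_lt {G : Type*} [Group G] [Finite G] (h : anz G < 1 / 2) :
    IsSupersolvable G := by
  have hpos : 0 < (Irr G).ncard :=
    (Set.ncard_pos (Irr.finite G)).mpr ⟨_, one_mem_Irr G⟩
  have hG : 2 * nz G < (Irr G).ncard := by
    rw [anz, div_lt_div_iff₀ (by exact_mod_cast hpos) (by norm_num)] at h
    have : nz G * 2 < 1 * (Irr G).ncard := by exact_mod_cast h
    omega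
  rcases linear_or_card_eq hG with hlin | ⟨hcard, hnz, hne⟩
  · have hcomm := mul_comm_of_Irr_subset_linearChars hlin
    refine IsSupersolvable.of_forall_normal ⊤ 1 (fun K _ => ⟨fun a ha g => ?_⟩) (by simp)
    rwa [hcomm g a, mul_inv_cancel_right]
  · have hof : ∀ g, g ∉ commutator G → Abelianization.of g ≠ 1 := fun g hg h1 =>
      hg ((QuotientGroup.eq_one_iff g).mp h1)
    exact isSupersolvable_of_index_two (N := commutator G) hcard fun g k hg hk =>
      isConj_of_nz_le_one hG hnz hne (hof g hg) (hof k hk)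

/-! ### The tetrahedral representation -/

/-- The signs describing the action of permutations of the vertices of a regular tetrahedron on its
three axes: the `i`-th axis separates `{i, 3}` from its complement. -/
def tetraSign (i : Fin 3) (k : Fin 4) : ℂ :=
  (![![1, -1, -1, 1], ![-1, 1, -1, 1], ![-1, -1, 1, 1]] : Fin 3 → Fin 4 → ℂ) i k

theorem sum_tetraSign (i : Fin 3) : ∑ k, tetraSign i k = 0 := by
  fin_cases i <;> simp [tetraSign, Fin.sum_univ_four]

/-- The columns of signs are the vertices of a regular tetrahedron inscribed in a cube. Their Gram
matrix is `4I - J`, with `J` the all-ones matrix. -/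
theorem sum_tetraSign_mul_tetraSign (y z : Fin 4) :
    ∑ m, tetraSign m y * tetraSign m z = if y = z then 3 else -1 := by
  fin_cases y <;> fin_cases z <;> simp [tetraSign, Fin.sum_univ_three] <;> norm_num

/-- The all-ones part of the Gram matrix kills vectors of sum zero, leaving multiplication by 4.
This cancels one of the two factors `1/4` in a product of tetrahedral matrices. -/
theorem sum_tetraSign_mul_sum (a : Fin 4 → ℂ) (ha : ∑ k, a k = 0) (y : Fin 4) :
    ∑ m, (∑ k, a k * tetraSign m k) * tetraSign m y = 4 * a y := by
  simp only [Finset.sum_mul, mul_assoc]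
  rw [Finset.sum_comm]
  simp only [← Finset.mul_sum, sum_tetraSign_mul_tetraSign]
  have : ∀ k, a k * (if k = y then 3 else -1) = (if k = y then 4 * a k else 0) - a k := by
    intro k
    split_ifs <;> ring
  simp only [this, Finset.sum_sub_distrib, ha, sub_zero]
  simp

/-- The matrix of the action of a permutation of the vertices of a regular tetrahedron. -/
noncomputable def tetraMatrix (g : Equiv.Perm (Fin 4)) : Matrix (Fin 3) (Fin 3) ℂ :=
  Matrix.of fun i j => (∑ k, tetraSign i (g k) * tetraSign j k) / 4

theorem tetraMatrix_mul (g h : Equiv.Perm (Fin 4)) :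
    tetraMatrix (g * h) = tetraMatrix g * tetraMatrix h := by
  ext i j
  have h0 : ∑ k, tetraSign i (g k) = 0 :=
    (Equiv.sum_comp g fun k => tetraSign i k).trans (sum_tetraSign i)
  have key := fun l => sum_tetraSign_mul_sum (fun k => tetraSign i (g k)) h0 (h l)
  have expand : ∑ m, (∑ k, tetraSign i (g k) * tetraSign m k) *
      (∑ l, tetraSign m (h l) * tetraSign j l) =
      4 * ∑ l, tetraSign i (g (h l)) * tetraSign j l := by
    simp only [Finset.mul_sum (Finset.univ : Finset (Fin 4)), ← mul_assoc]
    rw [Finset.sum_comm]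
    refine Finset.sum_congr rfl fun l _ => ?_
    rw [← Finset.sum_mul, key l]
  simp only [tetraMatrix, Matrix.mul_apply, Matrix.of_apply, Equiv.Perm.mul_apply, div_mul_div_comm,
    ← Finset.sum_div]
  rw [expand]
  ring

theorem tetraMatrix_one : tetraMatrix 1 = 1 := by
  ext i j
  fin_cases i <;> fin_cases j <;>
    simp [tetraMatrix, tetraSign, Fin.sum_univ_four] <;> norm_num

theorem trace_tetraMatrix (g : Equiv.Perm (Fin 4)) :
    (tetraMatrix g).trace = (∑ k, if g k = k then 1 else 0) - 1 := by
  simp only [tetraMatrix, Matrix.trace, Matrix.diag_apply, Matrix.of_apply, ← Finset.sum_div]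
  rw [Finset.sum_comm]
  simp only [sum_tetraSign_mul_tetraSign]
  have : ∀ k, (if g k = k then (3 : ℂ) else -1) = 4 * (if g k = k then 1 else 0) - 1 := by
    intro k
    split_ifs <;> ring
  simp only [this, Finset.sum_sub_distrib, ← Finset.mul_sum]
  simp
  ring

/-! ### Sharpness: the alternating group on four points -/

namespace AlternatingGroupFour

/-- A rotation of the tetrahedron of order three. -/
def rot : alternatingGroup (Fin 4) :=
  ⟨Equiv.swap 0 1 * Equiv.swap 1 2, Equiv.Perm.mem_alternatingGroup.mpr (by decide)⟩

/-- A rotation of the tetrahedron of order two. -/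
def flip : alternatingGroup (Fin 4) :=
  ⟨Equiv.swap 0 1 * Equiv.swap 2 3, Equiv.Perm.mem_alternatingGroup.mpr (by decide)⟩

/-- Another rotation of the tetrahedron of order two. -/
def flip' : alternatingGroup (Fin 4) :=
  ⟨Equiv.swap 0 2 * Equiv.swap 1 3, Equiv.Perm.mem_alternatingGroup.mpr (by decide)⟩

/-- The exponent of the rotation that a rotation of the tetrahedron induces on its three axes. -/
def axisRotation (g : alternatingGroup (Fin 4)) : ZMod 3 :=
  -- The two vertex pairs of axis `i` both have bitwise XOR `3 - i`. Negated modulo 3, the XOR of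
  -- the images of 0 and 3 is thus the index of the axis to which `g` sends axis 0.
  -((((g : Equiv.Perm (Fin 4)) 0 : ℕ) ^^^ ((g : Equiv.Perm (Fin 4)) 3 : ℕ) : ℕ) : ZMod 3)

theorem axisRotation_mul (g h : alternatingGroup (Fin 4)) :
    axisRotation (g * h) = axisRotation g + axisRotation h := by
  revert g h
  decide +kernel

theorem exists_conj_eq (g : alternatingGroup (Fin 4)) :
    ∃ r ∈ [1, flip, rot, rot * rot], ∃ h ∈ [1, flip, flip', flip * flip', rot, rot * rot],
      h * r = g * h := by
  revert g
  decide +kernel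

/-- Some conjugate of `g` avoids `1`, `g` and `g * g`, which exhaust the powers of `g` as orders in
`A₄` are at most 3. The conditions are cleared of inverses for the finite check. -/
theorem exists_conj_ne (g : alternatingGroup (Fin 4)) (hg : g ≠ 1) :
    ∃ h ∈ [rot, flip], h * g ≠ h ∧ h * g ≠ g * h ∧ h * g ≠ g * g * h := by
  revert g
  decide +kernel

theorem mul_self_eq_one_or (g : alternatingGroup (Fin 4)) : g * g = 1 ∨ g * g * g = 1 := by
  revert g
  decide +kernel

/-- The representation of `A₄` by rotations of a tetrahedron. -/
noncomputable def tetraRep : Representation ℂ (alternatingGroup (Fin 4)) (Fin 3 → ℂ) where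
  toFun g := Matrix.toLin' (tetraMatrix g)
  map_one' := by simp [tetraMatrix_one, Module.End.one_eq_id]
  map_mul' g h := by simp [tetraMatrix_mul, Matrix.toLin'_mul, Module.End.mul_eq_comp]

theorem character_tetraRep (g : alternatingGroup (Fin 4)) : tetraRep.character g =
    (∑ k, if (g : Equiv.Perm (Fin 4)) k = k then 1 else 0) - 1 := by
  rw [← trace_tetraMatrix]
  change LinearMap.trace ℂ _ (Matrix.toLin' (tetraMatrix g)) = _
  rw [Matrix.trace_toLin'_eq]

theorem tetraRep_flip (x : Fin 3 → ℂ) : tetraRep flip x = ![-x 0, -x 1, x 2] := by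
  change Matrix.toLin' (tetraMatrix (Equiv.swap 0 1 * Equiv.swap 2 3)) x = _
  have hk : ∀ k : Fin 4, (Equiv.swap 0 1 * Equiv.swap 2 3 : Equiv.Perm (Fin 4)) k = (![1, 0, 3, 2] : Fin 4 → Fin 4) k := by
    decide
  have : tetraMatrix (Equiv.swap 0 1 * Equiv.swap 2 3) = !![-1, 0, 0; 0, -1, 0; 0, 0, 1] := by
    ext i j
    fin_cases i <;> fin_cases j <;>
      simp [tetraMatrix, tetraSign, Fin.sum_univ_four, -Equiv.Perm.coe_mul, hk] <;>
      norm_num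
  rw [this, Matrix.toLin'_apply]
  ext i
  fin_cases i <;> simp [Matrix.mulVec, dotProduct, Fin.sum_univ_succ]

theorem tetraRep_rot (x : Fin 3 → ℂ) : tetraRep rot x = ![x 2, x 0, x 1] := by
  change Matrix.toLin' (tetraMatrix (Equiv.swap 0 1 * Equiv.swap 1 2)) x = _
  have hk : ∀ k : Fin 4, (Equiv.swap 0 1 * Equiv.swap 1 2 : Equiv.Perm (Fin 4)) k = (![1, 2, 0, 3] : Fin 4 → Fin 4) k := by
    decide
  have : tetraMatrix (Equiv.swap 0 1 * Equiv.swap 1 2) = !![0, 0, 1; 1, 0, 0; 0, 1, 0] := by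
    ext i j
    fin_cases i <;> fin_cases j <;>
      simp [tetraMatrix, tetraSign, Fin.sum_univ_four, -Equiv.Perm.coe_mul, hk] <;>
      norm_num
  rw [this, Matrix.toLin'_apply]
  ext i
  fin_cases i <;> simp [Matrix.mulVec, dotProduct, Fin.sum_univ_succ]

theorem tetraRep_isIrreducible : tetraRep.IsIrreducible := by
  refine IsIrreducible.mk_of_forall _ fun p hp hb => ?_
  -- Adding `x` to its image under `flip` leaves only the last coordinate, doubled. Rotating first
  -- brings any nonzero coordinate to that place.
  have hlast : ∀ x ∈ p, x 2 ≠ 0 → ![0, 0, 1] ∈ p := by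
    intro x hx h2
    have := p.smul_mem (2 * x 2)⁻¹ (p.add_mem hx (hp flip x hx))
    convert this using 1
    rw [tetraRep_flip]
    ext i
    simp only [Pi.smul_apply, Pi.add_apply, smul_eq_mul]
    fin_cases i
    · simp
    · simp
    · simp
      field_simp
      norm_num
  obtain ⟨x, hx, hx0⟩ := p.ne_bot_iff.mp hb
  have he2 : ![0, 0, 1] ∈ p := by
    by_cases h2 : x 2 = 0
    · have hr := hp rot x hx
      by_cases h1 : x 1 = 0
      · have hrr := hp rot _ hr
        refine hlast _ hrr fun h0 => hx0 (funext fun i => ?_)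
        rw [tetraRep_rot, tetraRep_rot] at h0
        fin_cases i
        · simpa using h0
        · exact h1
        · exact h2
      · refine hlast _ hr ?_
        rw [tetraRep_rot]
        simpa using h1
    · exact hlast x hx h2
  have he0 : ![1, 0, 0] ∈ p := by
    have := hp rot _ he2
    rw [tetraRep_rot] at this
    simpa using this
  have he1 : ![0, 1, 0] ∈ p := by
    have := hp rot _ he0
    rw [tetraRep_rot] at this
    simpa using this
  rw [eq_top_iff]
  intro y _
  have : y = y 0 • ![1, 0, 0] + y 1 • ![0, 1, 0] + y 2 • ![0, 0, 1] := by
    ext i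
    fin_cases i <;> simp
  rw [this]
  exact p.add_mem (p.add_mem (p.smul_mem _ he0) (p.smul_mem _ he1)) (p.smul_mem _ he2)

theorem character_tetraRep_mem : tetraRep.character ∈
    Irr (alternatingGroup (Fin 4)) \ linearChars (alternatingGroup (Fin 4)) := by
  refine ⟨⟨3, tetraRep, tetraRep_isIrreducible, rfl⟩, ?_⟩
  rintro ⟨φ, hφ⟩
  have := congrFun hφ 1
  rw [char_one, Module.finrank_fin_fun] at this
  norm_num at this

theorem mk_eq (c : ConjClasses (alternatingGroup (Fin 4))) :
    c = ConjClasses.mk 1 ∨ c = ConjClasses.mk flip ∨ c = ConjClasses.mk rot ∨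
      c = ConjClasses.mk (rot * rot) := by
  obtain ⟨g, rfl⟩ := ConjClasses.mk_surjective c
  obtain ⟨r, hr, h, -, hh⟩ := exists_conj_eq g
  have : ConjClasses.mk g = ConjClasses.mk r :=
    (ConjClasses.mk_eq_mk_iff_isConj.mpr (isConj_iff.mpr ⟨h, by rw [hh, mul_inv_cancel_right]⟩)).symm
  rw [this]
  simp only [List.mem_cons, List.not_mem_nil, or_false] at hr
  rcases hr with rfl | rfl | rfl | rfl <;> simp

theorem card_conjClasses_le : Nat.card (ConjClasses (alternatingGroup (Fin 4))) ≤ 4 := by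
  have hsurj : Function.Surjective (![ConjClasses.mk 1, ConjClasses.mk flip, ConjClasses.mk rot,
      ConjClasses.mk (rot * rot)] : Fin 4 → ConjClasses (alternatingGroup (Fin 4))) := by
    intro c
    rcases mk_eq c with rfl | rfl | rfl | rfl
    · exact ⟨0, rfl⟩
    · exact ⟨1, rfl⟩
    · exact ⟨2, rfl⟩
    · exact ⟨3, rfl⟩
  simpa using Nat.card_le_card_of_surjective _ hsurj

/-- The action of `A₄` on the three axes, as a homomorphism. -/
def axisHom : alternatingGroup (Fin 4) →* Multiplicative (ZMod 3) :=
  MonoidHom.mk' (fun g => Multiplicative.ofAdd (axisRotation g)) fun g h => by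
    rw [axisRotation_mul, ofAdd_add]

theorem axisHom_rot : axisHom rot = Multiplicative.ofAdd 1 := by decide

theorem axisHom_surjective : Function.Surjective axisHom := by
  intro a
  obtain ⟨k, rfl⟩ := Multiplicative.ofAdd.surjective a
  refine ⟨rot ^ k.val, ?_⟩
  rw [map_pow, axisHom_rot, ← ofAdd_nsmul, nsmul_one, ZMod.natCast_zmod_val]

/-- At least three linear characters come from the surjection onto `ZMod 3` and one nonlinear
character from the tetrahedron; four classes leave no room for more. -/
theorem ncard_Irr_eq : (Irr (alternatingGroup (Fin 4))).ncard = 4 ∧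
    (Irr (alternatingGroup (Fin 4)) \ linearChars (alternatingGroup (Fin 4))).ncard = 1 := by
  have h1 := Irr.ncard_le_card_conjClasses (alternatingGroup (Fin 4))
  have h2 := card_conjClasses_le
  have h3 := ncard_Irr (alternatingGroup (Fin 4))
  have h4 : 3 ≤ Nat.card (Abelianization (alternatingGroup (Fin 4))) := by
    have hs : Function.Surjective (Abelianization.lift axisHom) := fun a => by
      obtain ⟨g, rfl⟩ := axisHom_surjective a
      exact ⟨Abelianization.of g, Abelianization.lift_apply_of _ _⟩
    have := Nat.card_le_card_of_surjective _ hs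
    simpa using this
  have h5 := (Set.ncard_pos ((Irr.finite (alternatingGroup (Fin 4))).subset
    Set.sdiff_subset)).mpr ⟨_, character_tetraRep_mem⟩
  omega

theorem zeroClasses_character_tetraRep : zeroClasses tetraRep.character =
    {ConjClasses.mk rot, ConjClasses.mk (rot * rot)} := by
  have h1 : tetraRep.character 1 ≠ 0 := by simp
  have h2 : tetraRep.character flip ≠ 0 := by
    rw [character_tetraRep, Finset.sum_eq_zero]
    · norm_num
    · intro k _
      rw [if_neg]
      revert k
      decide
  have h3 : tetraRep.character rot = 0 := by
    rw [character_tetraRep, Finset.sum_eq_single 3, if_pos (by decide), sub_self]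
    · intro k _ hk
      rw [if_neg]
      revert k
      decide
    · simp
  have h4 : tetraRep.character (rot * rot) = 0 := by
    rw [character_tetraRep, Finset.sum_eq_single 3, if_pos (by decide), sub_self]
    · intro k _ hk
      rw [if_neg]
      revert k
      decide
    · simp
  have hmem := fun g => Irr.mk_mem_zeroClasses character_tetraRep_mem.1 (g := g)
  ext c
  rw [Set.mem_insert_iff, Set.mem_singleton_iff]
  constructor
  · intro hc
    rcases mk_eq c with rfl | rfl | h
    · exact absurd ((hmem 1).mp hc) h1
    · exact absurd ((hmem flip).mp hc) h2
    · exact h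
  · rintro (rfl | rfl)
    · exact (hmem _).mpr h3
    · exact (hmem _).mpr h4

theorem nz_eq : nz (alternatingGroup (Fin 4)) = 2 := by
  obtain ⟨χ, hχ⟩ := Set.ncard_eq_one.mp ncard_Irr_eq.2
  have hmem := character_tetraRep_mem
  rw [hχ, Set.mem_singleton_iff] at hmem
  have : charTableZeros (alternatingGroup (Fin 4)) =
      {tetraRep.character} ×ˢ zeroClasses tetraRep.character := by
    ext ⟨ψ, c⟩
    rw [Set.mem_prod, Set.mem_singleton_iff]
    constructor
    · rintro ⟨hψ, hz⟩
      have hnl : ψ ∉ linearChars (alternatingGroup (Fin 4)) := by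
        rintro ⟨φ, rfl⟩
        obtain ⟨g, rfl⟩ := ConjClasses.mk_surjective c
        exact (φ g).ne_zero (hz g ConjClasses.mem_carrier_mk)
      have : ψ ∈ ({χ} : Set _) := hχ ▸ ⟨hψ, hnl⟩
      obtain rfl : ψ = tetraRep.character := by rw [hmem, this]
      exact ⟨rfl, hz⟩
    · rintro ⟨rfl, hz⟩
      exact ⟨character_tetraRep_mem.1, hz⟩
  rw [nz, this, Set.ncard_prod, Set.ncard_singleton, one_mul, zeroClasses_character_tetraRep,
    Set.ncard_pair]
  -- `axisHom` has commutative target, so it is constant on classes, yet it separates `rot` from its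
  -- square.
  intro h
  obtain ⟨x, hx⟩ := isConj_iff.mp (ConjClasses.mk_eq_mk_iff_isConj.mp h)
  have := congrArg axisHom hx
  rw [map_mul, map_mul, map_inv, mul_inv_cancel_comm, map_mul, left_eq_mul, axisHom_rot] at this
  revert this
  decide

theorem anz_eq : anz (alternatingGroup (Fin 4)) = 1 / 2 := by
  rw [anz, nz_eq, ncard_Irr_eq.1]
  norm_num

theorem eq_bot_of_isCyclic_of_normal (N : Subgroup (alternatingGroup (Fin 4))) (hN : N.Normal)
    (hc : IsCyclic N) : N = ⊥ := by
  obtain ⟨⟨g, hg⟩, hgen⟩ := hc.exists_generator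
  have hmem : ∀ x ∈ N, x = 1 ∨ x = g ∨ x = g * g := by
    intro x hx
    obtain ⟨k, hk⟩ := hgen ⟨x, hx⟩
    obtain rfl : g ^ k = x := congrArg Subtype.val hk
    have h3 : g ^ (3 : ℤ) = 1 ∨ g ^ (2 : ℤ) = 1 := by
      rcases mul_self_eq_one_or g with h | h
      · exact Or.inr (by rw [← h, zpow_two])
      · exact Or.inl (by rw [← h, zpow_ofNat, pow_succ, pow_two])
    rcases h3 with h3 | h2
    · rw [← Int.emod_add_mul_ediv k 3, zpow_add, zpow_mul, h3, one_zpow, mul_one]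
      have : k % 3 = 0 ∨ k % 3 = 1 ∨ k % 3 = 2 := by omega
      rcases this with h | h | h <;> rw [h]
      · simp
      · simp
      · exact Or.inr (Or.inr (zpow_two g))
    · rw [← Int.emod_add_mul_ediv k 2, zpow_add, zpow_mul, h2, one_zpow, mul_one]
      have : k % 2 = 0 ∨ k % 2 = 1 := by omega
      rcases this with h | h <;> rw [h] <;> simp
  have hg1 : g = 1 := by
    by_contra hne
    obtain ⟨h, -, h1, h2, h3⟩ := exists_conj_ne g hne
    rcases hmem _ (hN.conj_mem g hg h) with he | he | he
    · exact h1 (by rw [mul_inv_eq_iff_eq_mul.mp he, one_mul])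
    · exact h2 (mul_inv_eq_iff_eq_mul.mp he)
    · exact h3 (mul_inv_eq_iff_eq_mul.mp he)
  rw [Subgroup.eq_bot_iff_forall]
  intro x hx
  rcases hmem x hx with h | h | h <;> simp [h, hg1]

/-- Once a term of the series is trivial, the next is isomorphic to its cyclic factor, hence a
cyclic normal subgroup and trivial too. The series never leaves `⊥`. -/
theorem not_isSupersolvable : ¬ IsSupersolvable (alternatingGroup (Fin 4)) := by
  rintro ⟨n, H, hH, h0, hlast, hstep⟩
  have hbot : ∀ i, H i = ⊥ := by
    intro i
    induction i using Fin.induction with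
    | zero => exact h0
    | succ i ih =>
      obtain ⟨-, hc⟩ := hstep i
      refine eq_bot_of_isCyclic_of_normal _ (hH i.succ) ?_
      refine isCyclic_of_injective
        (QuotientGroup.mk' ((H i.castSucc).subgroupOf (H i.succ))) ?_
      rw [← MonoidHom.ker_eq_bot_iff, QuotientGroup.ker_mk', ih, Subgroup.bot_subgroupOf]
  have h1 : rot ∈ H (Fin.last n) := hlast ▸ Subgroup.mem_top _
  rw [hbot, Subgroup.mem_bot] at h1
  revert h1
  decide

end AlternatingGroupFour

theorem theoremC :
    (∀ (G : Type*) [Group G] [Finite G], anz G < 1 / 2 → IsSupersolvable G) ∧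
      (anz (alternatingGroup (Fin 4)) = 1 / 2 ∧
        ¬ IsSupersolvable (alternatingGroup (Fin 4))) :=
  ⟨fun _ _ _ h => isSupersolvable_of_anz_lt h, AlternatingGroupFour.anz_eq,
    AlternatingGroupFour.not_isSupersolvable⟩
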